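/- \textbf{Proposition (Strong duality).} Let $\mathcal Z\subseteq\mathbb R^d$ be closed and non-empty, with the Euclidean norm $\|\cdot\|$, let $\mathcal P(\mathcal Z)$ be the set of Borel probability measures on $\mathcal Z$, and let $p\in[1,\infty)$, $\varepsilon\in[0,1)$, $\rho,\sigma\in\mathbb R$ and $z_0\in\mathbb R^d$. Let $\tilde\mu_n=\frac1n\sum_{i=1}^n\delta_{\tilde Z_i}$ with $n\ge1$ and $\tilde Z_1,\dots,\tilde Z_n\in\mathcal Z$. For $\mu,\nu\in\mathcal P(\mathcal Z)$ let $$\mathsf W_p(\mu,\nu)=\Bigl(\inf_{\pi\in\Pi(\mu,\nu)}\int\|x-y\|^p\,d\pi(x,y)\Bigr)^{1/p}\in[0,\infty],$$ where $\Pi(\mu,\nu)$ is the set of couplings of $\mu$ and $\nu$, and let $$\mathsf W_p^\varepsilon(\mu\|\nu)=\inf\Bigl\{\mathsf W_p(\mu',\nu):\ \mu'\in\mathcal P(\mathcal Z),\ \mu'\le\tfrac1{1-\varepsilon}\mu\Bigr\},\qquad \mathcal G_2(\sigma,z_0)=\bigl\{\nu\in\mathcal P(\mathcal Z):\ \mathbb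 E_\nu[\|Z-z_0\|^2]\le\sigma^2\bigr\}.$$ Assume Slater condition I: $\rho>0$, and there exists $\nu_0\in\mathcal P(\mathcal Z)$ with $\mathsf W_p^\varepsilon(\tilde\mu_n\|\nu_0)<\rho$ and $\mathbb E_{\nu_0}[\|Z-z_0\|^2]<\sigma^2$. Then for every lower semicontinuous $\ell:\mathcal Z\to\mathbb R$ with $\sup_{z\in\mathcal Z}\frac{\ell(z)}{1+\|z\|^p}<\infty$, $$\sup_{\substack{\nu\in\mathcal G_2(\sigma,z_0):\\ \mathsf W_p^\varepsilon(\tilde\mu_n\|\nu)\le\rho}}\mathbb E_\nu[\ell]\;=\;\inf_{\substack{\lambda_1,\lambda_2\ge0\\ \alpha\in\mathbb R}}\ \lambda_1\sigma^2+\lambda_2\rho^p+\alpha+\frac1{1-\varepsilon}\,\mathbb E_{\tilde\mu_n}\bigl[\overline\ell(\cdot\,;\lambda_1,\lambda_2,\alpha)\bigr],$$ where $\overline\ell(z;\lambda_1,\lambda_2,\alpha)=\sup_{\xi\in\mathcal Z}\bigl[\ell(\xi)-\lambda_1\|\xi-z_0\|^2-\lambda_2\|\xi-z\|^p-\alpha\bigr]_+\in[0,\infty]$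 and $[x]_+=\max\{x,0\}$. Here $\mathbb E_\nu[\ell]\in[-\infty,\infty)$ for every feasible $\nu$, and the equality is between extended real numbers. -/

import Mathlib

open MeasureTheory
open scoped ENNReal NNReal

noncomputable section

namespace OutlierRobustDRO

variable {d : ℕ}

/-- The couplings of two measures on `Z`: measures on `Z × Z` with marginals `μ` and `ν`. -/
def couplings {Z : Set (EuclideanSpace ℝ (Fin d))} (μ ν : Measure Z) : Set (Measure (Z × Z)) :=
  {π | π.map Prod.fst = μ ∧ π.map Prod.snd = ν}

/-- The `p`-Wasserstein distance for the Euclidean norm, with values in `[0, ∞]`. -/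
def wasserstein {Z : Set (EuclideanSpace ℝ (Fin d))} (p : ℝ) (μ ν : Measure Z) : ℝ≥0∞ :=
  (⨅ π ∈ couplings μ ν,
    ∫⁻ w, ‖(w.1 : EuclideanSpace ℝ (Fin d)) - (w.2 : EuclideanSpace ℝ (Fin d))‖ₑ ^ p ∂π) ^ (1 / p)

/-- The one-sided `ε`-outlier-robust `p`-Wasserstein distance `W_p^ε(μ ‖ ν)`: the infimum of
`W_p(μ', ν)` over probability measures `μ' ≤ (1 - ε)⁻¹ μ`. -/
def robustWasserstein {Z : Set (EuclideanSpace ℝ (Fin d))} (p ε : ℝ) (μ ν : Measure Z) : ℝ≥0∞ :=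
  ⨅ μ' ∈ {μ' : Measure Z | IsProbabilityMeasure μ' ∧ μ' ≤ ENNReal.ofReal (1 / (1 - ε)) • μ},
    wasserstein p μ' ν

/-- The empirical measure `(1 / n) ∑ᵢ δ_{x i}`. -/
def empirical {Z : Set (EuclideanSpace ℝ (Fin d))} {n : ℕ} (x : Fin n → Z) : Measure Z :=
  (n : ℝ≥0∞)⁻¹ • ∑ i, Measure.dirac (x i)

/-- The second moment `E_ν[‖Z - z₀‖²]` about `z₀`, with values in `[0, ∞]`. -/
def secondMoment {Z : Set (EuclideanSpace ℝ (Fin d))} (z₀ : EuclideanSpace ℝ (Fin d))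
    (ν : Measure Z) : ℝ≥0∞ :=
  ∫⁻ ξ, ‖(ξ : EuclideanSpace ℝ (Fin d)) - z₀‖ₑ ^ 2 ∂ν

/-- The class `𝒢₂(σ, z₀)` of probability measures on `Z` with `E_ν[‖Z - z₀‖²] ≤ σ²`. -/
def momentClass (Z : Set (EuclideanSpace ℝ (Fin d))) (σ : ℝ) (z₀ : EuclideanSpace ℝ (Fin d)) :
    Set (Measure Z) :=
  {ν | IsProbabilityMeasure ν ∧ secondMoment z₀ ν ≤ ENNReal.ofReal (σ ^ 2)}

/-- The expectation `E_ν[ℓ] = E_ν[ℓ⁺] - E_ν[ℓ⁻]`, with values in `[-∞, ∞]`. It is `-∞` exactly when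
the negative part has infinite expectation, as the positive part has finite expectation wherever
it is used below. -/
def expectation {Z : Set (EuclideanSpace ℝ (Fin d))} (ν : Measure Z) (ℓ : Z → ℝ) : EReal :=
  ((∫⁻ ξ, ENNReal.ofReal (ℓ ξ) ∂ν : ℝ≥0∞) : EReal) -
    ((∫⁻ ξ, ENNReal.ofReal (-ℓ ξ) ∂ν : ℝ≥0∞) : EReal)

/-- Slater's condition: `ρ > 0`, and some probability measure on `Z` satisfies both the
transport constraint and the moment constraint strictly. -/
def SlaterCondition {Z : Set (EuclideanSpace ℝ (Fin d))} (p ε ρ σ : ℝ) (μ : Measure Z)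
    (z₀ : EuclideanSpace ℝ (Fin d)) : Prop :=
  0 < ρ ∧ ∃ ν₀ : Measure Z, IsProbabilityMeasure ν₀ ∧
    robustWasserstein p ε μ ν₀ < ENNReal.ofReal ρ ∧ secondMoment z₀ ν₀ < ENNReal.ofReal (σ ^ 2)

/-- `sup_{ξ ∈ Z} [ℓ(ξ) - l₁ ‖ξ - z₀‖² - l₂ ‖ξ - z‖^p - α]₊`, with values in `[0, ∞]`
(`ENNReal.ofReal` is the positive part). -/
def dualLoss {Z : Set (EuclideanSpace ℝ (Fin d))} (p : ℝ) (ℓ : Z → ℝ)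
    (z₀ : EuclideanSpace ℝ (Fin d)) (l₁ l₂ : ℝ≥0) (α : ℝ) (z : Z) : ℝ≥0∞ :=
  ⨆ ξ : Z, ENNReal.ofReal
    (ℓ ξ - l₁ * ‖(ξ : EuclideanSpace ℝ (Fin d)) - z₀‖ ^ 2
      - l₂ * ‖(ξ : EuclideanSpace ℝ (Fin d)) - (z : EuclideanSpace ℝ (Fin d))‖ ^ p - α)

end OutlierRobustDRO

end

/-! Weak duality: for feasible `ν`, take a nearly optimal coupling of `ν` with some `μ' ≤ (1 - ε)⁻¹
μ` and integrate `ℓ ξ ≤ λ₁‖ξ - z₀‖² + λ₂‖ξ - z‖^p + α + dualLoss z` against it. The last term is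
nonnegative, so replacing `μ'` by `(1 - ε)⁻¹ μ` only increases the bound (`expectation_le_dual`).

Strong duality: the triples (cost, second moment, loss) of admissible plans form a convex set in
`ℝ³`. If `V` bounds the primal values, separating this set from an orthant gives multipliers
(`exists_multipliers`). Since `μ` is empirical, it is enough to test them on plans moving mass `m i`
from `x i` to one point `ξ i`. Maximising over each `ξ i` leaves a linear program over weights
capped by `c / n`, whose dual variable is `α` (`exists_capped_weights`).

The objective's multiplier is nonzero: otherwise the same elimination with zero loss gives a dual
certificate that weak duality at the Slater measure refutes. Passing through weak duality avoids
asking that `ℓ` be integrable for that measure. -/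

namespace OutlierRobustDRO

/-! ### Finite-dimensional convex duality -/

/-- Linear programming duality on the capped simplex: the maximum of `∑ i, m i * a i` over weights
`0 ≤ m i ≤ c` of total mass one equals `α + c * ∑ i, (a i - α)⁺` for a suitable `α`. -/
theorem exists_capped_weights {ι : Type*} [Fintype ι] [Nonempty ι] (c : ℝ)
    (hc : 1 ≤ c * Fintype.card ι) (a : ι → ℝ) :
    ∃ (α : ℝ) (m : ι → ℝ), (∀ i, 0 ≤ m i) ∧ (∀ i, m i ≤ c) ∧ ∑ i, m i = 1 ∧
      α + c * ∑ i, max (a i - α) 0 = ∑ i, m i * a i := by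
  classical
  have hc0 : 0 < c := by
    by_contra h
    have : c * Fintype.card ι ≤ 0 := mul_nonpos_of_nonpos_of_nonneg (not_lt.1 h) (by positivity)
    linarith
  -- The threshold `α` is an upper quantile: the largest value `a j` whose upper level set can hold
  -- mass one under the cap `c`.
  let J : Finset ι := {j | 1 ≤ c * (Finset.card {i | a j ≤ a i} : ℝ)}
  have hJ : J.Nonempty := by
    obtain ⟨j, hj⟩ := Finite.exists_min a
    refine ⟨j, ?_⟩
    simpa [J, hj] using hc
  obtain ⟨j, hjJ, hjmax⟩ := J.exists_max_image a hJ
  have hj : 1 ≤ c * (Finset.card {i | a j ≤ a i} : ℝ) := by simpa [J] using hjJ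
  set G : Finset ι := {i | a j < a i} with hG
  set E : Finset ι := {i | a i = a j} with hE
  have hjE : j ∈ E := by simp [hE]
  have hEpos : (0 : ℝ) < E.card := by exact_mod_cast Finset.card_pos.2 ⟨j, hjE⟩
  have hdisj : Disjoint G E := by
    rw [Finset.disjoint_left]; intro i hi hi'
    simp only [hG, hE, Finset.mem_filter, Finset.mem_univ, true_and] at hi hi'
    linarith
  have hunion : ({i | a j ≤ a i} : Finset ι) = G ∪ E := by
    ext i
    simp only [hG, hE, Finset.mem_filter, Finset.mem_univ, true_and, Finset.mem_union]
    rw [le_iff_lt_or_eq, eq_comm (a := a j)]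
  rw [hunion, Finset.card_union_of_disjoint hdisj] at hj
  push_cast at hj
  -- Otherwise the least value above the threshold would itself be a candidate, against maximality
  -- of `a j`.
  have hGlt : c * (G.card : ℝ) < 1 := by
    rcases G.eq_empty_or_nonempty with h | h
    · simp [h]
    · obtain ⟨k, hkG, hk⟩ := G.exists_min_image a h
      have hkG' : a j < a k := by simpa [hG] using hkG
      by_contra hcon
      have : k ∈ J := by
        have hsub : G ⊆ ({i | a k ≤ a i} : Finset ι) := fun i hi => by
          simpa using hk i hi
        have hcard : (G.card : ℝ) ≤ (Finset.card {i | a k ≤ a i} : ℝ) := by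
          exact_mod_cast Finset.card_le_card hsub
        have := mul_le_mul_of_nonneg_left hcard hc0.le
        simp only [J, Finset.mem_filter, Finset.mem_univ, true_and]
        linarith
      linarith [hjmax k this]
  -- Points above the threshold are filled to the cap; the remaining mass is shared equally among
  -- the ties.
  let β : ℝ := (1 - c * G.card) / E.card
  have hβ0 : 0 ≤ β := div_nonneg (by linarith) hEpos.le
  have hβc : β ≤ c := by rw [div_le_iff₀ hEpos]; linarith
  let m : ι → ℝ := fun i => (if i ∈ G then c else 0) + (if i ∈ E then β else 0)
  have hsum : ∑ i, m i = 1 := by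
    simp only [m, Finset.sum_add_distrib, Finset.sum_ite_mem, Finset.univ_inter,
      Finset.sum_const, nsmul_eq_mul, β]
    field_simp
    ring
  refine ⟨a j, m, fun i => ?_, fun i => ?_, hsum, ?_⟩
  · simp only [m]; split_ifs <;> linarith
  · by_cases hi : i ∈ G
    · have hi' := Finset.disjoint_left.1 hdisj hi
      simp [m, hi, hi']
    · simp only [m, if_neg hi]; split_ifs <;> linarith
  · have key : ∀ i, c * max (a i - a j) 0 = m i * (a i - a j) := by
      intro i
      rcases lt_trichotomy (a i) (a j) with h | h | h
      · have h1 : i ∉ G := by simp [hG, h.le]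
        have h2 : i ∉ E := by simp [hE, h.ne]
        simp [m, h1, h2, max_eq_right (sub_nonpos.2 h.le)]
      · simp [h]
      · have h1 : i ∈ G := by simp [hG, h]
        have h2 : i ∉ E := by simp [hE, h.ne']
        simp [m, h1, h2, max_eq_left (sub_nonneg.2 h.le)]
    rw [Finset.mul_sum, Finset.sum_congr rfl fun i _ => key i]
    simp only [mul_sub, Finset.sum_sub_distrib, ← Finset.sum_mul, hsum]
    ring

open scoped Pointwise in
/-- Fritz John multipliers for a convex image of two constraints and an objective. -/
theorem exists_multipliers {S : Set (ℝ × ℝ × ℝ)} (hS : Convex ℝ S) (hne : S.Nonempty)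
    (h : ∀ s ∈ S, s.1 < 0 → s.2.1 < 0 → s.2.2 ≤ 0) :
    ∃ l₀ l₁ l₂ : ℝ, 0 ≤ l₀ ∧ 0 ≤ l₁ ∧ 0 ≤ l₂ ∧ (l₀ = 0 → 0 < l₁ ∨ 0 < l₂) ∧
      ∀ s ∈ S, l₀ * s.2.2 ≤ l₁ * s.1 + l₂ * s.2.1 := by
  -- Adding this orthant makes the set open, encodes the hypothesis as `0 ∉ S + B`, and forces the
  -- signs of the separating functional.
  let B : Set (ℝ × ℝ × ℝ) := Set.Ioi 0 ×ˢ Set.Ioi 0 ×ˢ Set.Iio 0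
  have hBo : IsOpen B := isOpen_Ioi.prod (isOpen_Ioi.prod isOpen_Iio)
  have hBc : Convex ℝ B := (convex_Ioi 0).prod ((convex_Ioi 0).prod (convex_Iio 0))
  have h0 : (0 : ℝ × ℝ × ℝ) ∉ S + B := by
    rintro ⟨⟨t, r, v⟩, hs, ⟨t', r', v'⟩, ⟨ht, hr, hv⟩, heq⟩
    simp only [Set.mem_Ioi, Set.mem_Iio] at ht hr hv
    simp only [Prod.mk_add_mk, Prod.mk_eq_zero] at heq
    have := h _ hs (by simp only; linarith) (by simp only; linarith)
    simp only at this
    linarith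
  obtain ⟨f, hf⟩ := geometric_hahn_banach_open_point (hS.add hBc) (hBo.add_left) h0
  rw [map_zero] at hf
  have hfS : ∀ s ∈ S, ∀ t r v : ℝ, 0 < t → 0 < r → v < 0 →
      f s + (t * f (1, 0, 0) + r * f (0, 1, 0) + v * f (0, 0, 1)) < 0 := by
    intro s hs t r v ht hr hv
    have h1 := hf _ (Set.add_mem_add hs (show (t, r, v) ∈ B from ⟨ht, hr, hv⟩))
    have h2 : ((t, r, v) : ℝ × ℝ × ℝ)
        = t • (1, 0, 0) + r • (0, 1, 0) + v • (0, 0, 1) := by simp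
    rw [map_add, h2, map_add, map_add, map_smul, map_smul, map_smul] at h1
    simpa using h1
  have hfs : ∀ s : ℝ × ℝ × ℝ,
      f s = s.1 * f (1, 0, 0) + s.2.1 * f (0, 1, 0) + s.2.2 * f (0, 0, 1) := by
    rintro ⟨t, r, v⟩
    have h2 : ((t, r, v) : ℝ × ℝ × ℝ)
        = t • (1, 0, 0) + r • (0, 1, 0) + v • (0, 0, 1) := by simp
    conv_lhs => rw [h2]
    simp only [map_add, map_smul, smul_eq_mul]
  set a := f (1, 0, 0)
  set b := f (0, 1, 0)
  set c := f (0, 0, 1)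
  have hunb : ∀ K u : ℝ, (∀ t : ℝ, 0 < t → K + t * u < 0) → u ≤ 0 := by
    intro K u hK
    by_contra! hu
    have := hK ((|K| + 1) / u) (by positivity)
    rw [div_mul_cancel₀ _ hu.ne'] at this
    linarith [neg_abs_le K]
  obtain ⟨s₀, hs₀⟩ := hne
  have ha : a ≤ 0 := hunb (f s₀ + b - c) a fun t ht => by
    have := hfS s₀ hs₀ t 1 (-1) ht one_pos (by norm_num); linarith
  have hb : b ≤ 0 := hunb (f s₀ + a - c) b fun t ht => by
    have := hfS s₀ hs₀ 1 t (-1) one_pos ht (by norm_num); linarith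
  have hc : -c ≤ 0 := hunb (f s₀ + a + b) (-c) fun t ht => by
    have := hfS s₀ hs₀ 1 1 (-t) one_pos one_pos (by linarith); linarith
  refine ⟨c, -a, -b, by linarith, by linarith, by linarith, fun hc0 => ?_, fun s hs => ?_⟩
  · by_contra! hab
    have ha0 : a = 0 := by linarith
    have hb0 : b = 0 := by linarith
    have := hfS s₀ hs₀ 1 1 (-1) one_pos one_pos (by norm_num)
    rw [hfs s₀, ha0, hb0, hc0] at this
    simp at this
  -- The strict bound holds on `s + B`; the orthant shift is sent to zero.
  · have hle : f s ≤ 0 := by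
      refine le_of_forall_pos_le_add fun δ hδ => ?_
      have hK : 0 < 1 + |a + b - c| := by positivity
      have hδ' : 0 < δ / (1 + |a + b - c|) := by positivity
      have h1 := hfS s hs _ _ _ hδ' hδ' (neg_lt_zero.2 hδ')
      have h2 : δ / (1 + |a + b - c|) * (1 + |a + b - c|) = δ := div_mul_cancel₀ _ hK.ne'
      have h3 := mul_le_mul_of_nonneg_left (neg_abs_le (a + b - c)) hδ'.le
      nlinarith
    rw [hfs s] at hle
    linarith

/-! ### Empirical measures, norms and measurability -/

variable {d : ℕ} {Z : Set (EuclideanSpace ℝ (Fin d))}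

theorem isProbabilityMeasure_empirical {n : ℕ} (hn : 0 < n) (x : Fin n → Z) :
    IsProbabilityMeasure (empirical x) := by
  constructor
  have : (n : ℝ≥0∞) ≠ 0 := by exact_mod_cast hn.ne'
  simp [empirical, ENNReal.inv_mul_cancel this (ENNReal.natCast_ne_top n)]

theorem lintegral_empirical {n : ℕ} (x : Fin n → Z) (f : Z → ℝ≥0∞) :
    ∫⁻ z, f z ∂(empirical x) = (n : ℝ≥0∞)⁻¹ * ∑ i, f (x i) := by
  simp [empirical, lintegral_smul_measure]

theorem ofReal_norm_rpow {E : Type*} [SeminormedAddCommGroup E] (u : E) {p : ℝ} (hp : 0 ≤ p) :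
    ENNReal.ofReal (‖u‖ ^ p) = ‖u‖ₑ ^ p := by
  rw [← ENNReal.ofReal_rpow_of_nonneg (norm_nonneg _) hp, ofReal_norm]

theorem ofReal_norm_sq {E : Type*} [SeminormedAddCommGroup E] (u : E) :
    ENNReal.ofReal (‖u‖ ^ 2) = ‖u‖ₑ ^ 2 := by
  rw [ENNReal.ofReal_pow (norm_nonneg _), ofReal_norm]

/-- The supremum may run over uncountably many `ξ`, but each term is continuous in `z`, so the
supremum is lower semicontinuous. -/
theorem measurable_dualLoss {p : ℝ} (hp : 0 ≤ p) (ℓ : Z → ℝ) (z₀ : EuclideanSpace ℝ (Fin d))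
    (l₁ l₂ : ℝ≥0) (α : ℝ) : Measurable (dualLoss p ℓ z₀ l₁ l₂ α) := by
  refine LowerSemicontinuous.measurable ?_
  refine lowerSemicontinuous_iSup fun ξ => Continuous.lowerSemicontinuous ?_
  refine ENNReal.continuous_ofReal.comp ?_
  have : Continuous fun z : Z => ‖(ξ : EuclideanSpace ℝ (Fin d)) - z‖ ^ p :=
    (by fun_prop : Continuous fun z : Z => ‖(ξ : EuclideanSpace ℝ (Fin d)) - z‖).rpow_const
      fun _ => Or.inr hp
  fun_prop

/-! ### Weak duality -/

/-- An affine bound passes from a function to its expectation. -/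
theorem expectation_le_of_lintegral {ν : Measure Z} {ℓ : Z → ℝ} {K : ℝ≥0∞} {α : ℝ}
    (h : (∫⁻ ξ, ENNReal.ofReal (ℓ ξ) ∂ν) + ENNReal.ofReal (-α)
      ≤ (∫⁻ ξ, ENNReal.ofReal (-ℓ ξ) ∂ν) + K + ENNReal.ofReal α) :
    expectation ν ℓ ≤ ((α : ℝ) : EReal) + (K : EReal) := by
  unfold expectation
  generalize (∫⁻ ξ, ENNReal.ofReal (ℓ ξ) ∂ν) = A at *
  generalize (∫⁻ ξ, ENNReal.ofReal (-ℓ ξ) ∂ν) = B at *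
  by_cases hK : K = ⊤
  · simp [hK]
  -- Here the convention `⊤ - ⊤ = ⊥` in `EReal` matters: the expectation is `⊥` whatever `A` is.
  by_cases hB : B = ⊤
  · simp [hB, sub_eq_add_neg]
  have hA : A ≠ ⊤ := by
    rintro rfl
    simp [hK, hB] at h
  lift K to ℝ≥0 using hK
  lift B to ℝ≥0 using hB
  lift A to ℝ≥0 using hA
  have h' : (A : ℝ) + max (-α) 0 ≤ B + K + max α 0 := by
    have h2 := ENNReal.toReal_mono (by finiteness) h
    rw [ENNReal.toReal_add (by finiteness) (by finiteness),
      ENNReal.toReal_add (by finiteness) (by finiteness),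
      ENNReal.toReal_add (by finiteness) (by finiteness),
      ENNReal.toReal_ofReal', ENNReal.toReal_ofReal'] at h2
    simpa using h2
  have h3 : max α 0 - max (-α) 0 = α := by
    rcases le_total 0 α with h | h
    · simp [h]
    · simp [h]
  have : (A : ℝ) - B ≤ α + K := by linarith
  rw [EReal.coe_nnreal_eq_coe_real, EReal.coe_nnreal_eq_coe_real, EReal.coe_nnreal_eq_coe_real]
  exact_mod_cast this

/-- Weak duality, at a transport radius strictly above the robust distance. -/
theorem expectation_le_dual {p ε : ℝ} (hp : 1 ≤ p) {μ ν : Measure Z}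
    (z₀ : EuclideanSpace ℝ (Fin d)) {ρ s : ℝ} (hρ : 0 ≤ ρ) (hs : 0 ≤ s)
    (hν : IsProbabilityMeasure ν) (hW : robustWasserstein p ε μ ν < ENNReal.ofReal ρ)
    (hM : secondMoment z₀ ν ≤ ENNReal.ofReal s)
    {ℓ : Z → ℝ} (hℓ : Measurable ℓ) (l₁ l₂ : ℝ≥0) (α : ℝ) :
    expectation ν ℓ ≤ ((l₁ * s + l₂ * ρ ^ p + α : ℝ) : EReal) +
      ((ENNReal.ofReal (1 / (1 - ε)) * ∫⁻ z, dualLoss p ℓ z₀ l₁ l₂ α z ∂μ : ℝ≥0∞) : EReal) := by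
  have hp0 : 0 < p := by linarith
  simp only [robustWasserstein, iInf_lt_iff] at hW
  obtain ⟨μ', ⟨hμ', hle⟩, hW⟩ := hW
  have hW2 : (⨅ π ∈ couplings μ' ν, ∫⁻ w, ‖(w.1 : EuclideanSpace ℝ (Fin d)) -
      (w.2 : EuclideanSpace ℝ (Fin d))‖ₑ ^ p ∂π) < ENNReal.ofReal (ρ ^ p) := by
    rw [← ENNReal.ofReal_rpow_of_nonneg hρ hp0.le]
    rw [wasserstein, one_div] at hW
    by_contra! hcon
    have := ENNReal.rpow_le_rpow hcon (inv_nonneg.2 hp0.le)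
    rw [ENNReal.rpow_rpow_inv hp0.ne'] at this
    exact absurd hW (not_lt.2 this)
  simp only [iInf_lt_iff] at hW2
  obtain ⟨π, ⟨hπ1, hπ2⟩, hπ⟩ := hW2
  have hπp : IsProbabilityMeasure π := by
    constructor
    rw [← measure_univ (μ := ν), ← hπ2, Measure.map_apply measurable_snd MeasurableSet.univ]
    simp
  set s' := dualLoss p ℓ z₀ l₁ l₂ α with hs'
  -- The pointwise dual inequality, with negative parts moved across so that no truncated
  -- subtraction occurs and both sides can be integrated in `ℝ≥0∞`.
  have hpt : ∀ w : Z × Z, ENNReal.ofReal (ℓ w.2) + ENNReal.ofReal (-α) ≤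
      ENNReal.ofReal (-ℓ w.2) + (l₁ * ‖(w.2 : EuclideanSpace ℝ (Fin d)) - z₀‖ₑ ^ 2 +
        l₂ * ‖(w.1 : EuclideanSpace ℝ (Fin d)) - (w.2 : EuclideanSpace ℝ (Fin d))‖ₑ ^ p
          + s' w.1) + ENNReal.ofReal α := by
    intro w
    have h1 : ENNReal.ofReal (ℓ w.2 - l₁ * ‖(w.2 : EuclideanSpace ℝ (Fin d)) - z₀‖ ^ 2
      - l₂ * ‖(w.2 : EuclideanSpace ℝ (Fin d)) - (w.1 : EuclideanSpace ℝ (Fin d))‖ ^ p - α)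
        ≤ s' w.1 := le_iSup (fun ξ : Z => ENNReal.ofReal
          (ℓ ξ - l₁ * ‖(ξ : EuclideanSpace ℝ (Fin d)) - z₀‖ ^ 2
      - l₂ * ‖(ξ : EuclideanSpace ℝ (Fin d)) - (w.1 : EuclideanSpace ℝ (Fin d))‖ ^ p - α)) w.2
    rw [norm_sub_rev (w.2 : EuclideanSpace ℝ (Fin d)) (w.1 : EuclideanSpace ℝ (Fin d))] at h1
    rw [← ofReal_norm_rpow _ hp0.le, ← ofReal_norm_sq]
    generalize hq : ‖(w.2 : EuclideanSpace ℝ (Fin d)) - z₀‖ ^ 2 = q at *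
    generalize hr : ‖(w.1 : EuclideanSpace ℝ (Fin d)) - (w.2 : EuclideanSpace ℝ (Fin d))‖ ^ p
      = r at *
    have hq0 : 0 ≤ q := hq ▸ by positivity
    have hr0 : 0 ≤ r := hr ▸ by positivity
    refine le_trans ?_ (add_le_add_left (add_le_add_right (add_le_add_right h1 _) _) _)
    rw [← ENNReal.ofReal_coe_nnreal, ← ENNReal.ofReal_coe_nnreal,
      ← ENNReal.ofReal_mul (by positivity), ← ENNReal.ofReal_mul (by positivity),
      ← ENNReal.toReal_le_toReal (by finiteness) (by finiteness)]
    have hl1 : 0 ≤ l₁ * q := by positivity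
    have hl2 : 0 ≤ l₂ * r := by positivity
    repeat rw [ENNReal.toReal_add (by finiteness) (by finiteness)]
    simp only [ENNReal.toReal_ofReal']
    rw [max_eq_left hl1, max_eq_left hl2]
    have e1 : ∀ y : ℝ, max y 0 = y + max (-y) 0 := fun y => by
      rcases le_total 0 y with h | h <;> simp [h]
    rw [e1 (ℓ w.2), e1 α]
    linarith [le_max_left (ℓ w.2 - l₁ * q - l₂ * r - α) 0]
  have hint := lintegral_mono (μ := π) hpt
  rw [lintegral_add_right _ measurable_const, lintegral_add_right _ measurable_const,
    lintegral_add_left (by fun_prop), lintegral_add_left (by fun_prop),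
    lintegral_add_left (by fun_prop), lintegral_const_mul _ (by fun_prop),
    lintegral_const_mul _ (by fun_prop)] at hint
  simp only [lintegral_const, measure_univ, mul_one] at hint
  have hsnd : ∀ f : Z → ℝ≥0∞, Measurable f → ∫⁻ w, f w.2 ∂π = ∫⁻ ξ, f ξ ∂ν := fun f hf => by
    rw [← hπ2, lintegral_map hf measurable_snd]
  have hfst : ∫⁻ w, s' w.1 ∂π ≤ ENNReal.ofReal (1 / (1 - ε)) * ∫⁻ z, s' z ∂μ := by
    rw [← lintegral_map (measurable_dualLoss hp0.le ℓ z₀ l₁ l₂ α) measurable_fst, hπ1]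
    exact (lintegral_mono' hle le_rfl).trans_eq (lintegral_smul_measure _ _)
  rw [hsnd (fun ξ => ENNReal.ofReal (ℓ ξ)) (by fun_prop),
    hsnd (fun ξ => ENNReal.ofReal (-ℓ ξ)) (by fun_prop),
    hsnd (fun ξ => ‖(ξ : EuclideanSpace ℝ (Fin d)) - z₀‖ₑ ^ 2) (by fun_prop)] at hint
  set D := ENNReal.ofReal (1 / (1 - ε)) * ∫⁻ z, s' z ∂μ
  have hK := expectation_le_of_lintegral (K := ENNReal.ofReal (l₁ * s + l₂ * ρ ^ p) + D)
    (hint.trans (by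
      have hρp : 0 ≤ ρ ^ p := by positivity
      rw [ENNReal.ofReal_add (by positivity) (by positivity), ENNReal.ofReal_mul (by positivity),
        ENNReal.ofReal_mul (by positivity), ENNReal.ofReal_coe_nnreal, ENNReal.ofReal_coe_nnreal]
      gcongr
      exact hM))
  refine hK.trans_eq ?_
  have hρp : 0 ≤ l₁ * s + l₂ * ρ ^ p := by positivity
  rw [EReal.coe_ennreal_add, EReal.coe_ennreal_ofReal, max_eq_left hρp, ← add_assoc,
    ← EReal.coe_add, add_comm α]

/-- At the exact radius, attainment of the infima over `μ'` and over couplings is not needed: use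
each `r > ρ` and let `r ↓ ρ`, since the bound depends on `r` only through the continuous term `r ^
p`. -/
theorem expectation_le_dual_of_le {p ε : ℝ} (hp : 1 ≤ p) {μ ν : Measure Z}
    (z₀ : EuclideanSpace ℝ (Fin d)) {ρ s : ℝ} (hρ : 0 ≤ ρ) (hs : 0 ≤ s)
    (hν : IsProbabilityMeasure ν) (hW : robustWasserstein p ε μ ν ≤ ENNReal.ofReal ρ)
    (hM : secondMoment z₀ ν ≤ ENNReal.ofReal s)
    {ℓ : Z → ℝ} (hℓ : Measurable ℓ) (l₁ l₂ : ℝ≥0) (α : ℝ) :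
    expectation ν ℓ ≤ ((l₁ * s + l₂ * ρ ^ p + α : ℝ) : EReal) +
      ((ENNReal.ofReal (1 / (1 - ε)) * ∫⁻ z, dualLoss p ℓ z₀ l₁ l₂ α z ∂μ : ℝ≥0∞) : EReal) := by
  have key : ∀ r, ρ < r → expectation ν ℓ ≤ ((l₁ * s + l₂ * r ^ p + α : ℝ) : EReal) +
      ((ENNReal.ofReal (1 / (1 - ε)) * ∫⁻ z, dualLoss p ℓ z₀ l₁ l₂ α z ∂μ : ℝ≥0∞) : EReal) :=
    fun r hr => expectation_le_dual hp z₀ (hρ.trans hr.le) hs hν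
      (hW.trans_lt ((ENNReal.ofReal_lt_ofReal_iff (hρ.trans_lt hr)).2 hr)) hM hℓ l₁ l₂ α
  generalize (ENNReal.ofReal (1 / (1 - ε)) * ∫⁻ z, dualLoss p ℓ z₀ l₁ l₂ α z ∂μ) = D at *
  by_cases hD : D = ⊤
  · rw [hD, EReal.coe_ennreal_top, EReal.coe_add_top]
    exact le_top
  lift D to ℝ≥0 using hD
  have hcont : Continuous fun r : ℝ => ((l₁ * s + l₂ * r ^ p + α + D : ℝ) : EReal) := by
    have : Continuous fun r : ℝ => r ^ p := Real.continuous_rpow_const (by linarith)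
    exact continuous_coe_real_ereal.comp (by fun_prop)
  have hlim := ge_of_tendsto (hcont.continuousWithinAt (s := Set.Ioi ρ) (x := ρ)).tendsto
    (b := expectation ν ℓ) (by
      filter_upwards [self_mem_nhdsWithin] with r hr
      simpa [EReal.coe_add, EReal.coe_nnreal_eq_coe_real] using key r hr)
  simpa [EReal.coe_add, EReal.coe_nnreal_eq_coe_real] using hlim

/-! ### Transport plans and their values -/

/-- Probability measures on `Z × Z` with first marginal at most `c • μ`, for which the transport
cost, the second moment and the loss are integrable. -/
def plans (p : ℝ) (c : ℝ≥0) (μ : Measure Z) (z₀ : EuclideanSpace ℝ (Fin d)) (ℓ : Z → ℝ) :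
    Set (Measure (Z × Z)) :=
  {π | IsProbabilityMeasure π ∧ π.map Prod.fst ≤ c • μ ∧
    Integrable (fun w : Z × Z => ‖(w.2 : EuclideanSpace ℝ (Fin d)) - w.1‖ ^ p) π ∧
    Integrable (fun w : Z × Z => ‖(w.2 : EuclideanSpace ℝ (Fin d)) - z₀‖ ^ 2) π ∧
    Integrable (fun w : Z × Z => ℓ w.2) π}

/-- The transport cost, the second moment and the expected loss of a plan. -/
noncomputable def planValue (p : ℝ) (z₀ : EuclideanSpace ℝ (Fin d)) (ℓ : Z → ℝ) (π : Measure (Z × Z)) :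
    ℝ × ℝ × ℝ :=
  (∫ w : Z × Z, ‖(w.2 : EuclideanSpace ℝ (Fin d)) - w.1‖ ^ p ∂π,
    ∫ w : Z × Z, ‖(w.2 : EuclideanSpace ℝ (Fin d)) - z₀‖ ^ 2 ∂π, ∫ w : Z × Z, ℓ w.2 ∂π)

/-- Mixtures of plans are plans: the marginal bound is preserved, and all three integrals are affine
along mixtures thanks to integrability. -/
theorem convex_image_planValue (p : ℝ) (c : ℝ≥0) (μ : Measure Z)
    (z₀ : EuclideanSpace ℝ (Fin d)) (ℓ : Z → ℝ) :
    Convex ℝ (planValue p z₀ ℓ '' plans p c μ z₀ ℓ) := by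
  rintro _ ⟨π₁, ⟨h₁, m₁, i₁, j₁, k₁⟩, rfl⟩ _ ⟨π₂, ⟨h₂, m₂, i₂, j₂, k₂⟩, rfl⟩ a b ha hb hab
  lift a to ℝ≥0 using ha
  lift b to ℝ≥0 using hb
  have hab' : a + b = 1 := by exact_mod_cast hab
  have hint : ∀ f : Z × Z → ℝ, Integrable f π₁ → Integrable f π₂ →
      Integrable f (a • π₁ + b • π₂) := fun f hf₁ hf₂ =>
    (hf₁.smul_measure_nnreal).add_measure (hf₂.smul_measure_nnreal)
  have hval : ∀ f : Z × Z → ℝ, Integrable f π₁ → Integrable f π₂ →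
      ∫ w, f w ∂(a • π₁ + b • π₂) = a * ∫ w, f w ∂π₁ + b * ∫ w, f w ∂π₂ := fun f hf₁ hf₂ => by
    rw [integral_add_measure hf₁.smul_measure_nnreal hf₂.smul_measure_nnreal,
      integral_smul_nnreal_measure, integral_smul_nnreal_measure]
    rfl
  refine ⟨a • π₁ + b • π₂, ⟨⟨?_⟩, ?_, hint _ i₁ i₂, hint _ j₁ j₂, hint _ k₁ k₂⟩, ?_⟩
  · have : (a : ℝ≥0∞) + b = 1 := by exact_mod_cast hab'
    simpa only [Measure.add_apply, Measure.coe_nnreal_smul_apply, measure_univ, mul_one] using this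
  · rw [Measure.map_add _ _ measurable_fst, Measure.map_smul, Measure.map_smul]
    calc a • π₁.map Prod.fst + b • π₂.map Prod.fst ≤ a • (c • μ) + b • (c • μ) := by
          gcongr
      _ = c • μ := by rw [← add_smul, hab', one_smul]
  · simp only [planValue, hval _ i₁ i₂, hval _ j₁ j₂, hval _ k₁ k₂]
    rfl

/-- A plan satisfying the constraints yields a feasible distribution with the same value. -/
theorem exists_feasible_of_plan {p : ℝ} (hp : 1 ≤ p) {ε : ℝ} {c : ℝ≥0} (hc : c = 1 / (1 - ε))
    {μ : Measure Z} {z₀ : EuclideanSpace ℝ (Fin d)} {ℓ : Z → ℝ} (hℓ : Measurable ℓ)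
    {ρ σ : ℝ} (hρ : 0 ≤ ρ) {π : Measure (Z × Z)} (hπ : π ∈ plans p c μ z₀ ℓ)
    (hT : (planValue p z₀ ℓ π).1 ≤ ρ ^ p) (hR : (planValue p z₀ ℓ π).2.1 ≤ σ ^ 2) :
    ∃ ν ∈ momentClass Z σ z₀, robustWasserstein p ε μ ν ≤ ENNReal.ofReal ρ ∧
      expectation ν ℓ = ((planValue p z₀ ℓ π).2.2 : ℝ) := by
  have hp0 : 0 < p := by linarith
  obtain ⟨hπp, hm, iT, iR, iL⟩ := hπ
  refine ⟨π.map Prod.snd, ⟨Measure.isProbabilityMeasure_map measurable_snd.aemeasurable, ?_⟩,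
    ?_, ?_⟩
  · rw [secondMoment, lintegral_map (by fun_prop) measurable_snd]
    simp_rw [← ofReal_norm_sq]
    rw [← ofReal_integral_eq_lintegral_ofReal iR (Filter.Eventually.of_forall fun w => by
      simp only [Pi.zero_apply]; positivity)]
    exact ENNReal.ofReal_le_ofReal hR
  -- The first marginal of the plan serves as `μ'`, and the plan itself as the coupling.
  · refine (iInf₂_le (π.map Prod.fst)
      ⟨Measure.isProbabilityMeasure_map measurable_fst.aemeasurable, ?_⟩).trans ?_
    swap
    · rw [← hc, ENNReal.ofReal_coe_nnreal]
      exact hm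
    · rw [wasserstein]
      calc _ ≤ (ENNReal.ofReal (ρ ^ p)) ^ (1 / p) := by
            refine ENNReal.rpow_le_rpow ((iInf₂_le π ⟨rfl, rfl⟩).trans ?_) (by positivity)
            simp_rw [← ofReal_norm_rpow _ hp0.le]
            refine le_trans (le_of_eq ?_) (ENNReal.ofReal_le_ofReal hT)
            rw [planValue, ofReal_integral_eq_lintegral_ofReal iT
              (Filter.Eventually.of_forall fun w => by simp only [Pi.zero_apply]; positivity)]
            refine lintegral_congr fun w => ?_
            rw [norm_sub_rev]
        _ = ENNReal.ofReal ρ := by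
            rw [← ENNReal.ofReal_rpow_of_nonneg hρ hp0.le, one_div,
              ENNReal.rpow_rpow_inv hp0.ne']
  · rw [expectation, lintegral_map (by fun_prop) measurable_snd,
      lintegral_map (by fun_prop) measurable_snd, planValue,
      integral_eq_lintegral_pos_part_sub_lintegral_neg_part iL]
    have h1 : ∫⁻ w : Z × Z, ENNReal.ofReal (ℓ w.2) ∂π ≠ ⊤ := iL.lintegral_lt_top.ne
    have h2 : ∫⁻ w : Z × Z, ENNReal.ofReal (-ℓ w.2) ∂π ≠ ⊤ := iL.neg.lintegral_lt_top.ne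
    rw [EReal.coe_sub, EReal.coe_ennreal_toReal h1, EReal.coe_ennreal_toReal h2]

/-- Plans that send each sample to a single point. -/
theorem exists_plan_of_weights {p : ℝ} {n : ℕ} (x : Fin n → Z) {c : ℝ≥0}
    (z₀ : EuclideanSpace ℝ (Fin d)) (ℓ : Z → ℝ)
    {m : Fin n → ℝ≥0} (hm : ∀ i, m i ≤ c / n) (hsum : ∑ i, m i = 1) (ξ : Fin n → Z) :
    ∃ π ∈ plans p c (empirical x) z₀ ℓ, planValue p z₀ ℓ π =
      (∑ i, m i * ‖(ξ i : EuclideanSpace ℝ (Fin d)) - x i‖ ^ p,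
        ∑ i, m i * ‖(ξ i : EuclideanSpace ℝ (Fin d)) - z₀‖ ^ 2, ∑ i, m i * ℓ (ξ i)) := by
  have hint : ∀ f : Z × Z → ℝ, ∀ i, Integrable f (m i • Measure.dirac (x i, ξ i)) := fun f i =>
    (integrable_dirac (by simp)).smul_measure_nnreal
  have hint' : ∀ f : Z × Z → ℝ, Integrable f (∑ i, m i • Measure.dirac (x i, ξ i)) := fun f =>
    integrable_finsetSum_measure.2 fun i _ => hint f i
  have hval : ∀ f : Z × Z → ℝ, ∫ w, f w ∂(∑ i, m i • Measure.dirac (x i, ξ i)) =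
      ∑ i, m i * f (x i, ξ i) := fun f => by
    rw [integral_finsetSum_measure fun i _ => hint f i]
    refine Finset.sum_congr rfl fun i _ => ?_
    rw [integral_smul_nnreal_measure, integral_dirac]
    rfl
  refine ⟨∑ i, m i • Measure.dirac (x i, ξ i), ⟨⟨?_⟩, ?_, hint' _, hint' _, hint' _⟩, ?_⟩
  · have : ∑ i, (m i : ℝ≥0∞) = 1 := by exact_mod_cast hsum
    simpa only [Measure.finsetSum_apply, Measure.coe_nnreal_smul_apply, measure_univ, mul_one]
      using this
  · rcases Nat.eq_zero_or_pos n with rfl | hn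
    · simp at hsum
    have hn0 : (n : ℝ≥0) ≠ 0 := by exact_mod_cast hn.ne'
    rw [Measure.le_iff]
    intro s hs
    rw [Measure.map_apply measurable_fst hs]
    simp only [empirical, Measure.coe_finsetSum, Finset.sum_apply, Measure.smul_apply,
      Measure.dirac_apply' _ (measurable_fst hs), Measure.dirac_apply' _ hs, Finset.smul_sum]
    refine Finset.sum_le_sum fun i _ => ?_
    have h1 : (m i : ℝ≥0∞) ≤ c * (n : ℝ≥0∞)⁻¹ := by
      have := hm i
      rw [div_eq_mul_inv] at this
      calc (m i : ℝ≥0∞) ≤ ((c * (n : ℝ≥0)⁻¹ : ℝ≥0) : ℝ≥0∞) := by exact_mod_cast this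
        _ = c * (n : ℝ≥0∞)⁻¹ := by
          rw [ENNReal.coe_mul, ENNReal.coe_inv hn0, ENNReal.coe_natCast]
    simp only [ENNReal.smul_def, smul_eq_mul]
    rw [← mul_assoc]
    gcongr
    exact le_rfl
  · simp only [planValue, hval]

/-! ### Strong duality -/

/-- Elimination of the pointwise Lagrangian suprema by duality on the capped simplex. -/
theorem exists_dual_of_lagrangian_le {p ε : ℝ} (hε₀ : 0 ≤ ε) (hε₁ : ε < 1) {n : ℕ} (hn : 0 < n)
    (x : Fin n → Z) (z₀ : EuclideanSpace ℝ (Fin d)) (ℓ : Z → ℝ) {c : ℝ≥0} (hc : c = 1 / (1 - ε))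
    (l₁ l₂ : ℝ≥0) (U : ℝ)
    (h : ∀ m : Fin n → ℝ≥0, (∀ i, m i ≤ c / n) → ∑ i, m i = 1 → ∀ ξ : Fin n → Z,
      ∑ i, m i * (ℓ (ξ i) - l₁ * ‖(ξ i : EuclideanSpace ℝ (Fin d)) - z₀‖ ^ 2
        - l₂ * ‖(ξ i : EuclideanSpace ℝ (Fin d)) - x i‖ ^ p) ≤ U) :
    ∃ α D : ℝ, α + D ≤ U ∧ ENNReal.ofReal (1 / (1 - ε)) *
      ∫⁻ z, dualLoss p ℓ z₀ l₁ l₂ α z ∂(empirical x) ≤ ENNReal.ofReal D ∧ 0 ≤ D := by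
  have hn' : (0 : ℝ) < n := by exact_mod_cast hn
  have : Nonempty (Fin n) := ⟨⟨0, hn⟩⟩
  have : Nonempty Z := ⟨x ⟨0, hn⟩⟩
  have hc1 : (1 : ℝ) ≤ c := by
    rw [hc, le_div_iff₀ (by linarith)]; linarith
  set g : Fin n → Z → ℝ := fun i ξ => ℓ ξ - l₁ * ‖(ξ : EuclideanSpace ℝ (Fin d)) - z₀‖ ^ 2
        - l₂ * ‖(ξ : EuclideanSpace ℝ (Fin d)) - x i‖ ^ p with hg
  have hbdd : ∀ i, BddAbove (Set.range (g i)) := by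
    intro i
    -- Uniform weights are admissible because `1 ≤ c`; varying only the `i`-th target isolates `g i
    -- ξ`. Without this bound the real supremum `φ i` would be a default value.
    refine ⟨n * U - ∑ j ∈ Finset.univ.erase i, g j (x i) , ?_⟩
    rintro _ ⟨ξ, rfl⟩
    have h1 := h (fun _ => (n : ℝ≥0)⁻¹) (fun j => ?_) ?_ (Function.update (fun _ => x i) i ξ)
    · change ∑ j, (((n : ℝ≥0)⁻¹ : ℝ≥0) : ℝ) * g j (Function.update (fun _ => x i) i ξ j) ≤ U at h1
      rw [← Finset.mul_sum, ← Finset.add_sum_erase _ _ (Finset.mem_univ i),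
        Function.update_self] at h1
      rw [Finset.sum_congr rfl fun j hj => by
        rw [Function.update_of_ne (Finset.ne_of_mem_erase hj)]] at h1
      push_cast at h1
      rw [inv_mul_le_iff₀ hn'] at h1
      linarith
    · rw [div_eq_mul_inv]
      exact le_mul_of_one_le_left (by positivity) (by exact_mod_cast hc1)
    · simp [hn.ne']
  set φ : Fin n → ℝ := fun i => ⨆ ξ, g i ξ with hφ
  obtain ⟨α, m, hm0, hmc, hm1, hα⟩ := exists_capped_weights (c / n : ℝ) (by
    rw [Fintype.card_fin, div_mul_cancel₀ _ hn'.ne']; exact hc1) φ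
  lift m to Fin n → ℝ≥0 using hm0
  have hU : ∑ i, m i * φ i ≤ U := by
    refine le_of_forall_pos_le_add fun δ hδ => ?_
    -- The suprema need not be attained; `δ`-optimal targets cost `δ` in total, as the weights sum
    -- to one.
    have hex : ∀ i, ∃ ξ, φ i - δ < g i ξ := fun i =>
      exists_lt_of_lt_ciSup (by simp only [hφ]; linarith)
    choose ξ hξ using hex
    have h1 := h m (fun i => by exact_mod_cast hmc i) (by rw [← NNReal.coe_inj, NNReal.coe_sum]; exact hm1) ξ
    change ∑ i, m i * g i (ξ i) ≤ U at h1
    have h2 : ∑ i, m i * (φ i - δ) ≤ ∑ i, m i * g i (ξ i) :=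
      Finset.sum_le_sum fun i _ => mul_le_mul_of_nonneg_left (hξ i).le (m i).2
    simp only [mul_sub, Finset.sum_sub_distrib, ← Finset.sum_mul, hm1] at h2
    linarith
  have hloss : ∀ i, dualLoss p ℓ z₀ l₁ l₂ α (x i) ≤ ENNReal.ofReal (max (φ i - α) 0) := fun i =>
    iSup_le fun ξ => ENNReal.ofReal_le_ofReal
      ((sub_le_sub_right (le_ciSup (hbdd i) ξ) α).trans (le_max_left _ _))
  have hD0 : 0 ≤ ∑ i, max (φ i - α) 0 := Finset.sum_nonneg fun i _ => le_max_right _ _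
  refine ⟨α, c / n * ∑ i, max (φ i - α) 0, hα.trans_le hU, ?_, by positivity⟩
  rw [lintegral_empirical, ← hc, ← mul_assoc, ENNReal.ofReal_mul (by positivity),
    ENNReal.ofReal_div_of_pos hn', ENNReal.ofReal_natCast, ← div_eq_mul_inv,
    ENNReal.ofReal_sum_of_nonneg fun i _ => le_max_right _ _]
  gcongr with i
  exact hloss i

/-- Slater's condition makes the multiplier of the objective positive. -/
theorem SlaterCondition.false_of_dual_zero {p ε ρ σ : ℝ} (hp : 1 ≤ p)
    {μ : Measure Z} {z₀ : EuclideanSpace ℝ (Fin d)} (hS : SlaterCondition p ε ρ σ μ z₀)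
    {l₁ l₂ : ℝ≥0} (hl : 0 < l₁ ∨ 0 < l₂) {α D : ℝ} (hD0 : 0 ≤ D)
    (hD : ENNReal.ofReal (1 / (1 - ε)) *
      ∫⁻ z, dualLoss p (fun _ => 0) z₀ l₁ l₂ α z ∂μ ≤ ENNReal.ofReal D)
    (hU : l₁ * σ ^ 2 + l₂ * ρ ^ p + α + D ≤ 0) : False := by
  obtain ⟨hρ, ν, hν, hW, hM⟩ := hS
  -- Weak duality at a smaller radius `r` and moment bound `s` gains a strict inequality in
  -- whichever constraint has a positive multiplier.
  obtain ⟨r, hr0, hWr, hrρ⟩ := ENNReal.lt_iff_exists_real_btwn.1 hW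
  have hrρ' : r < ρ := (ENNReal.ofReal_lt_ofReal_iff hρ).1 hrρ
  obtain ⟨s, hs0, hMs, hsσ⟩ := ENNReal.lt_iff_exists_real_btwn.1 hM
  have hsσ' : s < σ ^ 2 := (ENNReal.ofReal_lt_ofReal_iff_of_nonneg hs0).1 hsσ
  have h := expectation_le_dual hp z₀ hr0 hs0 hν hWr hMs.le (ℓ := fun _ => 0)
    measurable_const l₁ l₂ α
  have h2 : ((0 : ℝ) : EReal) ≤ ((l₁ * s + l₂ * r ^ p + α + D : ℝ) : EReal) := by
    have h3 : expectation ν (fun _ => 0) = ((0 : ℝ) : EReal) := by simp [expectation]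
    rw [← h3, EReal.coe_add]
    refine h.trans (add_le_add_right ?_ _)
    refine (EReal.coe_ennreal_le_coe_ennreal_iff.2 hD).trans_eq ?_
    rw [EReal.coe_ennreal_ofReal, max_eq_left hD0]
  have h4 : 0 ≤ l₁ * s + l₂ * r ^ p + α + D := by exact_mod_cast h2
  have h5 : r ^ p < ρ ^ p := Real.rpow_lt_rpow hr0 hrρ' (by linarith)
  have h6 : (l₁ : ℝ) * s ≤ l₁ * σ ^ 2 := by gcongr
  have h7 : (l₂ : ℝ) * r ^ p ≤ l₂ * ρ ^ p := by gcongr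
  rcases hl with hl | hl
  · have : (l₁ : ℝ) * s < l₁ * σ ^ 2 := by gcongr
    linarith
  · have : (l₂ : ℝ) * r ^ p < l₂ * ρ ^ p := by gcongr
    linarith

/-- Strong duality against a real upper bound of the primal values. -/
theorem exists_dual_le {p ε ρ σ : ℝ} (hp : 1 ≤ p) (hε₀ : 0 ≤ ε) (hε₁ : ε < 1) {n : ℕ}
    (hn : 0 < n) (x : Fin n → Z) {z₀ : EuclideanSpace ℝ (Fin d)}
    (hS : SlaterCondition p ε ρ σ (empirical x) z₀) {ℓ : Z → ℝ} (hℓ : Measurable ℓ) {V : ℝ}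
    (hV : ∀ ν ∈ momentClass Z σ z₀, robustWasserstein p ε (empirical x) ν ≤ ENNReal.ofReal ρ →
      expectation ν ℓ ≤ V) :
    ∃ (l₁ l₂ : ℝ≥0) (α D : ℝ), l₁ * σ ^ 2 + l₂ * ρ ^ p + α + D ≤ V ∧
      ENNReal.ofReal (1 / (1 - ε)) * ∫⁻ z, dualLoss p ℓ z₀ l₁ l₂ α z ∂(empirical x)
        ≤ ENNReal.ofReal D ∧ 0 ≤ D := by
  obtain ⟨c, hc⟩ : ∃ c : ℝ≥0, (c : ℝ) = 1 / (1 - ε) :=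
    ⟨⟨1 / (1 - ε), one_div_nonneg.2 (by linarith)⟩, rfl⟩
  have hc1 : 1 ≤ c := by
    rw [← NNReal.coe_le_coe, hc, NNReal.coe_one, le_div_iff₀ (by linarith)]; linarith
  set b : ℝ × ℝ × ℝ := (ρ ^ p, σ ^ 2, V) with hb
  have hconv := (convex_image_planValue p c (empirical x) z₀ ℓ).translate (-b)
  -- The transport cost is the first coordinate, so the first constraint multiplier is `l₂`.
  obtain ⟨l₀, l₂, l₁, hl₀, hl₂, hl₁, hpos, hmul⟩ := exists_multipliers hconv (by
    refine Set.Nonempty.image _ (Set.Nonempty.image _ ?_)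
    obtain ⟨π, hπ, -⟩ := exists_plan_of_weights (p := p) x (c := c) z₀ ℓ
      (m := fun _ => (n : ℝ≥0)⁻¹)
      (fun i => by
        rw [div_eq_mul_inv]
        exact le_mul_of_one_le_left (by positivity) hc1)
      (by simp [hn.ne']) x
    exact ⟨π, hπ⟩) (by
    rintro _ ⟨_, ⟨π, hπ, rfl⟩, rfl⟩ h1 h2
    simp only [hb, Prod.fst_add, Prod.snd_add, Prod.fst_neg, Prod.snd_neg] at h1 h2 ⊢
    obtain ⟨ν, hν, hW, hE⟩ := exists_feasible_of_plan hp hc hℓ hS.1.le hπ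
      (ρ := ρ) (σ := σ) (by linarith) (by linarith)
    have h3 := hV ν hν hW
    rw [hE] at h3
    have h4 : (planValue p z₀ ℓ π).2.2 ≤ V := by exact_mod_cast h3
    linarith)
  lift l₁ to ℝ≥0 using hl₁
  lift l₂ to ℝ≥0 using hl₂
  have hdisc : ∀ m : Fin n → ℝ≥0, (∀ i, m i ≤ c / n) → ∑ i, m i = 1 → ∀ ξ : Fin n → Z,
      l₀ * (∑ i, m i * ℓ (ξ i) - V) ≤
        l₂ * (∑ i, m i * ‖(ξ i : EuclideanSpace ℝ (Fin d)) - x i‖ ^ p - ρ ^ p) +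
        l₁ * (∑ i, m i * ‖(ξ i : EuclideanSpace ℝ (Fin d)) - z₀‖ ^ 2 - σ ^ 2) := by
    intro m hm hm1 ξ
    obtain ⟨π, hπ, hval⟩ := exists_plan_of_weights (p := p) x z₀ ℓ hm hm1 ξ
    have := hmul _ ⟨_, ⟨π, hπ, rfl⟩, rfl⟩
    rw [hval] at this
    simp only [hb, Prod.fst_add, Prod.snd_add, Prod.fst_neg, Prod.snd_neg] at this
    linarith
  have hexp : ∀ (m : Fin n → ℝ≥0) (ξ : Fin n → Z) (f : Z → ℝ) (a b : ℝ),
      ∑ i, m i * (f (ξ i) - a * ‖(ξ i : EuclideanSpace ℝ (Fin d)) - z₀‖ ^ 2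
        - b * ‖(ξ i : EuclideanSpace ℝ (Fin d)) - x i‖ ^ p) = ∑ i, m i * f (ξ i)
        - a * ∑ i, m i * ‖(ξ i : EuclideanSpace ℝ (Fin d)) - z₀‖ ^ 2
        - b * ∑ i, m i * ‖(ξ i : EuclideanSpace ℝ (Fin d)) - x i‖ ^ p := by
    intro m ξ f a b
    simp only [Finset.mul_sum, ← Finset.sum_sub_distrib]
    exact Finset.sum_congr rfl fun i _ => by ring
  rcases hl₀.eq_or_lt with h0 | h0
  · exfalso
    have hl : 0 < l₁ ∨ 0 < l₂ := by
      rcases hpos h0.symm with h | h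
      · exact Or.inr (by exact_mod_cast h)
      · exact Or.inl (by exact_mod_cast h)
    -- With `l₀ = 0` the separation inequality is a Lagrangian bound for the zero loss.
    obtain ⟨α, D, hU, hD, hD0⟩ := exists_dual_of_lagrangian_le (p := p) hε₀ hε₁ hn x z₀
      (fun _ => 0) hc l₁ l₂ (-(l₁ * σ ^ 2 + l₂ * ρ ^ p)) fun m hm hm1 ξ => by
        rw [hexp m ξ (fun _ => 0)]
        have := hdisc m hm hm1 ξ
        rw [← h0] at this
        simp only [mul_zero, Finset.sum_const_zero]
        linarith
    exact hS.false_of_dual_zero hp hl hD0 hD (by linarith)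
  · lift l₀ to ℝ≥0 using hl₀
    obtain ⟨α, D, hU, hD, hD0⟩ := exists_dual_of_lagrangian_le (p := p) hε₀ hε₁ hn x z₀
      ℓ hc (l₁ / l₀) (l₂ / l₀) (V - (l₁ / l₀ * σ ^ 2 + l₂ / l₀ * ρ ^ p)) fun m hm hm1 ξ => by
        rw [hexp m ξ ℓ]
        have := hdisc m hm hm1 ξ
        rw [← le_div_iff₀' h0, add_div, mul_div_right_comm, mul_div_right_comm] at this
        push_cast
        linarith
    refine ⟨l₁ / l₀, l₂ / l₀, α, D, ?_, hD, hD0⟩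
    push_cast
    linarith

end OutlierRobustDRO

theorem mainTheorem7 {d n : ℕ} (hn : 0 < n) (Z : Set (EuclideanSpace ℝ (Fin d)))
    (hZ : IsClosed Z) (hZne : Z.Nonempty)
    (p ε ρ σ : ℝ) (hp : 1 ≤ p) (hε₀ : 0 ≤ ε) (hε₁ : ε < 1)
    (x : Fin n → Z) (z₀ : EuclideanSpace ℝ (Fin d))
    (hSlater : OutlierRobustDRO.SlaterCondition p ε ρ σ (OutlierRobustDRO.empirical x) z₀)
    (ℓ : Z → ℝ) (hℓ : LowerSemicontinuous ℓ)
    (hgrowth : BddAbove (Set.range fun z : Z =>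
      ℓ z / (1 + ‖(z : EuclideanSpace ℝ (Fin d))‖ ^ p))) :
    (⨆ ν ∈ {ν : Measure Z | ν ∈ OutlierRobustDRO.momentClass Z σ z₀ ∧
        OutlierRobustDRO.robustWasserstein p ε (OutlierRobustDRO.empirical x) ν
          ≤ ENNReal.ofReal ρ},
      OutlierRobustDRO.expectation ν ℓ) =
    ⨅ (l₁ : ℝ≥0) (l₂ : ℝ≥0) (α : ℝ),
      ((l₁ * σ ^ 2 + l₂ * ρ ^ p + α : ℝ) : EReal) +
        ((ENNReal.ofReal (1 / (1 - ε)) *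
          ∫⁻ z, OutlierRobustDRO.dualLoss p ℓ z₀ l₁ l₂ α z
            ∂(OutlierRobustDRO.empirical x) : ℝ≥0∞) : EReal) := by
  have hℓm : Measurable ℓ := hℓ.measurable
  apply le_antisymm
  · refine iSup₂_le fun ν hν => le_iInf fun l₁ => le_iInf fun l₂ => le_iInf fun α => ?_
    exact OutlierRobustDRO.expectation_le_dual_of_le hp z₀ hSlater.1.le (sq_nonneg σ)
      hν.1.1 hν.2 hν.1.2 hℓm l₁ l₂ α
  -- Comparing with real `V` above the supremum gives a finite bound to separate at, even when the
  -- supremum is `⊥`.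
  · refine EReal.le_of_forall_lt_iff_le.1 fun V hV => ?_
    obtain ⟨l₁, l₂, α, D, hU, hD, hD0⟩ := OutlierRobustDRO.exists_dual_le hp hε₀ hε₁ hn x hSlater
      hℓm (V := V) fun ν hν hW => (le_iSup₂ (f := fun ν _ => OutlierRobustDRO.expectation ν ℓ)
        ν ⟨hν, hW⟩).trans hV.le
    refine (iInf_le_of_le l₁ (iInf_le_of_le l₂ (iInf_le _ α))).trans ?_
    refine le_trans (add_le_add_right (EReal.coe_ennreal_le_coe_ennreal_iff.2 hD) _) ?_
    rw [EReal.coe_ennreal_ofReal, max_eq_left hD0, ← EReal.coe_add]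
    exact_mod_cast hU
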